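/- **Conventions.** A tournament is an irreflexive binary relation $\to$ on a set such that for any two distinct vertices $a,b$ exactly one of $a\to b$, $b\to a$ holds. Let $\mathcal T$ be the random tournament, i.e. the countable tournament, unique up to isomorphism, which is homogeneous (every isomorphism between finite subtournaments extends to an automorphism) and whose finite subtournaments are, up to isomorphism, exactly all finite tournaments. The group $\mathrm{Aut}(\mathcal T)$ carries the Borel structure of the (Polish) topology of pointwise convergence. For a countable set $\mathcal L=\{R_i\}$ of relation symbols of arities $n_i$, let $\mathrm{Mod}_{\mathcal L}=\prod_i\mathcal P(\mathbb N^{n_i})$ be the space of $\mathcal L$-structures with universe $\mathbb N$, with the product of the Cantor topologies. Countable tournaments are regarded as the points of the Borel set of those $R\in\mathcal P(\mathbb N^2)$ that are tournaments on $\mathbb N$. For equivalence relations $E,F$ on standard Borel spaces $X,Y$, $E$ is *Borel reducible* to $F$ if there is a Borel map $f\colon X\to Y$ with $x\mathrel{E}x'\iff f(x)\mathrel{F}f(x')$ for all $x,x'\in X$. $E$ is *Borel complete* if for every countable relational language $\mathcal L$ and every Borel class $C\subseteq\mathrm{Mod}_{\mathcal L}$, the isomorphism relation on $C$ is Borel reducible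 to $E$. **Theorem.** The isomorphism relation for countable tournaments is Borel reducible to the conjugacy relation on $\mathrm{Aut}(\mathcal T)$. Hence the conjugacy relation on $\mathrm{Aut}(\mathcal T)$ is Borel complete. -/

import Mathlib

/-- A tournament: an irreflexive relation `R` (read `R a b` as `a → b`) such that between any two
distinct vertices there is an edge in exactly one of the two directions. -/
structure IsTournament {V : Type*} (R : V → V → Prop) : Prop where
  irrefl : ∀ a, ¬ R a a
  total : ∀ a b, a ≠ b → Xor (R a b) (R b a)

/-- A relational structure `(V, R)` is homogeneous if every isomorphism between two finite
substructures (given as a map `f` that is an embedding on a finite set `S`) extends to an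
automorphism. -/
def IsHomogeneousRel {V : Type*} (R : V → V → Prop) : Prop :=
  ∀ (S : Finset V) (f : V → V), Set.InjOn f (S : Set V) →
    (∀ a ∈ S, ∀ b ∈ S, R a b ↔ R (f a) (f b)) →
    ∃ φ : R ≃r R, ∀ a ∈ S, φ a = f a

/-- `(V, R)` is generic for the class of finite tournaments: it is homogeneous, and its finite
substructures are, up to isomorphism, exactly the finite tournaments. A countable such `(V, R)`
is a random tournament. -/
structure IsRandomTournament {V : Type*} (R : V → V → Prop) : Prop where
  homogeneous : IsHomogeneousRel R
  age : ∀ (n : ℕ) (r : Fin n → Fin n → Prop), Nonempty (r ↪r R) ↔ IsTournament r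

/-- The σ-algebra on `Aut(V, R)` generated by the evaluation maps `φ ↦ φ v`. For countable `V` it
is the Borel σ-algebra of the Polish topology of pointwise convergence. -/
instance autMeasurableSpace {V : Type*} (R : V → V → Prop) : MeasurableSpace (R ≃r R) :=
  ⨆ v : V, MeasurableSpace.comap (fun φ : R ≃r R => φ v) ⊤

/-- The space of structures with universe `ℕ` in the relational language with one relation symbol
of arity `arity i` for each `i : I`, with the product σ-algebra. For countable `I` it is the Borel
σ-algebra of the product of the Cantor topologies on the power sets. -/
abbrev ModSpace {I : Type} (arity : I → ℕ) : Type :=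
  (i : I) → Set (Fin (arity i) → ℕ)

/-- Isomorphism of structures with universe `ℕ`. -/
def isoSetoid {I : Type} (arity : I → ℕ) : Setoid (ModSpace arity) where
  r M N := ∃ g : Equiv.Perm ℕ, ∀ (i : I) (x : Fin (arity i) → ℕ), x ∈ M i ↔ g ∘ x ∈ N i
  iseqv :=
    { refl := fun _ => ⟨1, fun _ _ => Iff.rfl⟩
      symm := by
        rintro M N ⟨g, hg⟩
        refine ⟨g.symm, fun i x => ?_⟩
        rw [hg i (g.symm ∘ x), ← Function.comp_assoc, Equiv.self_comp_symm, Function.id_comp]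
      trans := by
        rintro M N K ⟨g, hg⟩ ⟨h, hh⟩
        exact ⟨g.trans h, fun i x => (hg i x).trans (hh i (g ∘ x))⟩ }

/-- The isomorphism relation restricted to a class `C` of structures. -/
def isoOn {I : Type} {arity : I → ℕ} (C : Set (ModSpace arity)) : Setoid C :=
  (isoSetoid arity).comap Subtype.val

/-- Borel reducibility `E ≤_B F`. -/
def BorelReducible {X Y : Type*} [MeasurableSpace X] [MeasurableSpace Y]
    (E : Setoid X) (F : Setoid Y) : Prop :=
  ∃ f : X → Y, Measurable f ∧ ∀ x x' : X, E x x' ↔ F (f x) (f x')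

/-- `E` is Borel complete: for every countable relational language and every Borel class `C` of
structures with universe `ℕ`, isomorphism on `C` is Borel reducible to `E`. -/
def BorelComplete {X : Type*} [MeasurableSpace X] (E : Setoid X) : Prop :=
  ∀ (I : Type) [Countable I] (arity : I → ℕ) (C : Set (ModSpace arity)),
    MeasurableSet C → BorelReducible (isoOn C) E

/-- The class of tournaments with vertex set `ℕ`, in the language of one binary relation. -/
def tournaments : Set (ModSpace (fun _ : Unit => 2)) :=
  {M | IsTournament (fun a b : ℕ => ![a, b] ∈ M ())}

/-- The conjugacy relation on a group. -/
abbrev conjugacy (G : Type*) [Group G] : Setoid G := IsConj.setoid G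

/-- The spaces of structures are standard Borel. -/
instance modSpace_standardBorel {I : Type} [Countable I] (arity : I → ℕ) :
    StandardBorelSpace (ModSpace arity) := by
  have h : ∀ i, StandardBorelSpace (Set (Fin (arity i) → ℕ)) := fun i =>
    inferInstanceAs (StandardBorelSpace ((Fin (arity i) → ℕ) → Prop))
  infer_instance

/-- The tournaments form a Borel class. -/
theorem measurableSet_tournaments : MeasurableSet tournaments := by
  have key : ∀ a b : ℕ, MeasurableSet {M : ModSpace (fun _ : Unit => 2) | ![a, b] ∈ M ()} := by
    intro a b
    exact (measurable_set_mem (![a, b] : Fin 2 → ℕ)).comp (measurable_pi_apply ()) |>.setOf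
  have : tournaments = (⋂ a : ℕ, {M | ![a, a] ∈ M ()}ᶜ) ∩
      ⋂ a : ℕ, ⋂ b : ℕ, {M | a ≠ b → Xor (![a, b] ∈ M ()) (![b, a] ∈ M ())} := by
    ext M
    simp only [tournaments, Set.mem_ofPred_eq, Set.mem_inter_iff, Set.mem_iInter, Set.mem_compl_iff]
    exact ⟨fun h => ⟨h.1, h.2⟩, fun h => ⟨h.1, h.2⟩⟩
  rw [this]
  refine (MeasurableSet.iInter fun a => (key a a).compl).inter
    (MeasurableSet.iInter fun a => MeasurableSet.iInter fun b => ?_)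
  by_cases hab : a = b
  · simp [hab]
  · simp only [ne_eq, hab, not_false_eq_true, true_imp_iff, Xor]
    exact ((key a b).inter (key b a).compl).union ((key b a).inter (key a b).compl)

/-- The automorphism group of a countable structure is a standard Borel space. -/
instance aut_standardBorel {V : Type*} [Countable V] (R : V → V → Prop) :
    StandardBorelSpace (R ≃r R) := by
  let _ : MeasurableSpace V := ⊤
  have : DiscreteMeasurableSpace V := ⟨fun _ => trivial⟩
  let A : Set (V → V) := {f | Function.Injective f ∧ Function.Surjective f ∧
    ∀ a b, R (f a) (f b) ↔ R a b}
  have hev : ∀ (a : V) (s : Set V), MeasurableSet {f : V → V | f a ∈ s} := fun a s =>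
    measurable_pi_apply a (MeasurableSet.of_discrete (s := s))
  have hA : MeasurableSet A := by
    have hA' : A = (⋂ a : V, ⋂ b : V, {f | f a = f b → a = b}) ∩
        ((⋂ b : V, ⋃ a : V, {f | f a ∈ ({b} : Set V)}) ∩
        ⋂ a : V, ⋂ b : V, {f | R (f a) (f b) ↔ R a b}) := by
      ext f
      simp [A, Function.Injective, Function.Surjective]
    have hpair : ∀ (a b : V) (s : Set (V × V)), MeasurableSet {f : V → V | (f a, f b) ∈ s} :=
      fun a b s => ((measurable_pi_apply a).prodMk (measurable_pi_apply b))
        (MeasurableSet.of_discrete (s := s))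
    rw [hA']
    refine (MeasurableSet.iInter fun a => MeasurableSet.iInter fun b => ?_).inter
      ((MeasurableSet.iInter fun b => MeasurableSet.iUnion fun a => hev a {b}).inter
      (MeasurableSet.iInter fun a => MeasurableSet.iInter fun b => ?_))
    · exact hpair a b {p | p.1 = p.2 → a = b}
    · exact hpair a b {p | R p.1 p.2 ↔ R a b}
  have := hA.standardBorel
  let e : A ≃ (R ≃r R) :=
    { toFun := fun f => ⟨Equiv.ofBijective f.1 ⟨f.2.1, f.2.2.1⟩, fun {a b} => f.2.2.2 a b⟩
      invFun := fun φ => ⟨φ, φ.injective, φ.surjective, fun _ _ => φ.map_rel_iff⟩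
      left_inv := fun _ => rfl
      right_inv := fun _ => by ext; rfl }
  have he : Measurable e := by
    refine Measurable.of_le_map ?_
    refine iSup_le fun v => ?_
    rw [← measurable_iff_le_map, measurable_comap_iff]
    exact (measurable_pi_apply v).comp measurable_subtype_coe
  have he' : Measurable e.symm := by
    refine Measurable.subtype_mk (measurable_pi_iff.2 fun v => ?_)
    exact measurable_iff_comap_le.2 (le_iSup
      (fun v : V => MeasurableSpace.comap (fun φ : R ≃r R => φ v) ⊤) v)
  let E : (R ≃r R) ≃ᵐ A := ⟨e.symm, he', he⟩
  let _ := upgradeStandardBorel A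
  let _ : TopologicalSpace (R ≃r R) := TopologicalSpace.induced E inferInstance
  have hb : BorelSpace (R ≃r R) := E.measurableEmbedding.borelSpace ⟨rfl⟩
  have hp : PolishSpace (R ≃r R) := E.toEquiv.polishSpace_induced
  infer_instance

/-! A countable structure is coded by colours (subsets of `ℕ`) on the vertices of one fixed
countable graph, whose vertices serve as labels. From the colours one builds a tournament on `ℕ × ℤ`
having translation of the second coordinate as an automorphism. Each orbit carries a label; the
edges inside an orbit spell out the colour of its label; the edges from a vertex into another orbit
are constant near `+∞` and near `-∞`. The two limits agree when the labels are equal; otherwise they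
differ and tell whether the labels are adjacent. Hence the coloured graph can be read off from the
tournament with its shift (`IsGenericPattern.exists_perm`).

The patterns between orbits are chosen once, independently of the structure, and generically subject
to this constraint. Genericity gives one-point extensions, so the tournament is a copy of the random
one. It also lets every isomorphism of coloured graphs lift, by back-and-forth, to an isomorphism
commuting with the shifts (`IsGenericPattern.exists_relIso`). So two structures are isomorphic iff
their shifts, transported to the random tournament, are conjugate. The transport is Borel because
its back-and-forth always takes the least available choice (`exists_measurable_backAndForth`). This
treats all languages at once; tournaments are a special case. -/

/-! ### One-point extensions in the random tournament -/

/-- Every pattern of edges over a finite set of vertices is realised by a vertex outside of it. -/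
def HasOnePointExtensions {V : Type*} (R : V → V → Prop) : Prop :=
  ∀ (S : Finset V) (ε : V → Prop), ∃ v, v ∉ S ∧ ∀ s ∈ S, (R v s ↔ ε s)

theorem IsTournament.rel_iff_not {V : Type*} {R : V → V → Prop} (h : IsTournament R) {a b : V}
    (hab : a ≠ b) : R a b ↔ ¬ R b a := by
  have := h.total a b hab
  simp only [Xor] at this
  tauto

theorem isTournament_of_iff {V : Type*} {R : V → V → Prop} (h : ∀ a, ¬ R a a)
    (h' : ∀ a b, a ≠ b → (R a b ↔ ¬ R b a)) : IsTournament R :=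
  ⟨h, fun a b hab => by
    have := h' a b hab
    simp only [Xor]
    tauto⟩

theorem IsRandomTournament.isTournament {V : Type*} {R : V → V → Prop}
    (hR : IsRandomTournament R) : IsTournament R := by
  have key : ∀ (n : ℕ) (e : Fin n ↪ V), IsTournament (fun i j => R (e i) (e j)) := fun n e =>
    (hR.age n _).1 ⟨⟨e, Iff.rfl⟩⟩
  refine ⟨fun a => ?_, fun a b hab => ?_⟩
  · exact (key 1 ⟨fun _ => a, fun _ _ _ => Subsingleton.elim _ _⟩).irrefl 0
  · refine (key 2 ⟨![a, b], ?_⟩).total 0 1 (by decide)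
    intro i j hij
    fin_cases i <;> fin_cases j <;> simp_all

/-- Adjoin to `S` a new vertex with the pattern `ε`. The age contains the resulting finite
tournament, and homogeneity moves its copy of `S` back onto `S`. -/
theorem IsRandomTournament.hasOnePointExtensions {V : Type*} {R : V → V → Prop}
    (hR : IsRandomTournament R) : HasOnePointExtensions R := by
  classical
  intro S ε
  have hT := hR.isTournament
  let R' : Option S → Option S → Prop := fun x y =>
    match x, y with
    | none, none => False
    | none, some s => ε s
    | some s, none => ¬ ε s
    | some s, some t => R s t
  have hR' : IsTournament R' := by
    refine isTournament_of_iff ?_ ?_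
    · rintro (_ | a)
      · exact id
      · exact hT.irrefl _
    · rintro (_ | a) (_ | b) hab
      · exact absurd rfl hab
      · simp [R']
      · simp [R']
      · refine hT.rel_iff_not fun h => hab ?_
        rw [Subtype.ext h]
  let e := Fintype.equivFin (Option S)
  have hr : IsTournament (fun i j => R' (e.symm i) (e.symm j)) :=
    ⟨fun i => hR'.irrefl _, fun i j hij => hR'.total _ _ (e.symm.injective.ne hij)⟩
  obtain ⟨j⟩ := (hR.age _ _).2 hr
  let J : Option S → V := fun x => j (e x)
  have hJ : Function.Injective J := j.injective.comp e.injective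
  have hJR : ∀ x y, R (J x) (J y) ↔ R' x y := fun x y => by
    simpa using j.map_rel_iff (a := e x) (b := e y)
  have hJs : Function.Injective (fun s : S => J (some s)) :=
    hJ.comp (Option.some_injective _)
  let f : V → V := Function.extend (fun s : S => J (some s)) Subtype.val id
  have hf : ∀ s : S, f (J (some s)) = s := fun s => hJs.extend_apply _ _ s
  obtain ⟨φ, hφ⟩ := hR.homogeneous (Finset.univ.image fun s : S => J (some s)) f
    (by
      intro x hx y hy hxy
      simp only [Finset.coe_image, Finset.coe_univ, Set.image_univ, Set.mem_range] at hx hy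
      obtain ⟨s, rfl⟩ := hx
      obtain ⟨t, rfl⟩ := hy
      rw [hf, hf] at hxy
      rw [Subtype.ext hxy])
    (by
      intro x hx y hy
      simp only [Finset.mem_image, Finset.mem_univ, true_and] at hx hy
      obtain ⟨s, rfl⟩ := hx
      obtain ⟨t, rfl⟩ := hy
      rw [hf, hf, hJR])
  have hφ' : ∀ s : S, φ (J (some s)) = s := fun s => by
    rw [hφ _ (Finset.mem_image_of_mem _ (Finset.mem_univ s)), hf]
  refine ⟨φ (J none), fun hmem => ?_, fun s hs => ?_⟩
  · have := hφ' ⟨_, hmem⟩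
    exact absurd (hJ (φ.injective this)) (by simp)
  · have := hφ' ⟨s, hs⟩
    have h2 : R (φ (J none)) (φ (J (some ⟨s, hs⟩))) ↔ ε s := by rw [φ.map_rel_iff, hJR]
    rwa [this] at h2

/-! ### Measurable back-and-forth -/

/-- A back-and-forth argument that depends measurably on a parameter. The partial isomorphisms are
the finite lists of pairs that are pairwise compatible. -/
theorem exists_measurable_backAndForth {X A B : Type*} [MeasurableSpace X] [Countable A]
    [Countable B] [Nonempty A] (C : X → A × B → A × B → Prop)
    (hmeas : ∀ q q', MeasurableSet {x | C x q q'})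
    (hinj : ∀ x q q', C x q q' → (q.1 = q'.1 ↔ q.2 = q'.2))
    (hsymm : ∀ x q q', C x q q' → C x q' q)
    (forth : ∀ x (p : List (A × B)), (∀ q ∈ p, ∀ q' ∈ p, C x q q') →
      ∀ a, ∃ b, C x (a, b) (a, b) ∧ ∀ q ∈ p, C x (a, b) q)
    (back : ∀ x (p : List (A × B)), (∀ q ∈ p, ∀ q' ∈ p, C x q q') →
      ∀ b, ∃ a, C x (a, b) (a, b) ∧ ∀ q ∈ p, C x (a, b) q) :
    ∃ h : X → A ≃ B, (∀ x a a', C x (a, h x a) (a', h x a')) ∧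
      ∀ a b, MeasurableSet {x | h x a = b} := by
  classical
  obtain hX | ⟨⟨x₀⟩⟩ := isEmpty_or_nonempty X
  · exact ⟨fun x => isEmptyElim x, fun x => isEmptyElim x, fun a b => by
      rw [Set.eq_empty_of_isEmpty {x : X | _}]; exact MeasurableSet.empty⟩
  have hne : Nonempty (A × B) := by
    obtain ⟨a⟩ := ‹Nonempty A›
    obtain ⟨b, -⟩ := forth x₀ [] (by simp) a
    exact ⟨(a, b)⟩
  obtain ⟨e, he⟩ := exists_surjective_nat (A × B)
  obtain ⟨t, ht⟩ := exists_surjective_nat (A ⊕ B)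
  let Task : ℕ → A × B → Prop := fun n q => Sum.elim (fun a => q.1 = a) (fun b => q.2 = b) (t n)
  let P : ℕ → List (A × B) → X → ℕ → Prop := fun n p x k =>
    Task n (e k) ∧ C x (e k) (e k) ∧ ∀ q ∈ p, C x (e k) q
  have hPm : ∀ n p k, MeasurableSet {x | P n p x k} := by
    intro n p k
    refine (MeasurableSet.const _).inter ((hmeas _ _).inter ?_)
    have : {x | ∀ q ∈ p, C x (e k) q} = ⋂ q ∈ {q | q ∈ p}, {x | C x (e k) q} := by
      ext x; simp
    change MeasurableSet {x | ∀ q ∈ p, C x (e k) q}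
    rw [this]
    exact MeasurableSet.biInter (Set.to_countable _) fun q _ => hmeas _ _
  -- Stated as an implication so that `Nat.find` is defined for every list; whenever a suitable pair
  -- exists, the least index of one is found.
  have hP' : ∀ n p x, ∃ k, (∃ k', P n p x k') → P n p x k := fun n p x => by
    by_cases h : ∃ k', P n p x k'
    · exact ⟨h.choose, fun _ => h.choose_spec⟩
    · exact ⟨0, fun h' => absurd h' h⟩
  let pick : ℕ → List (A × B) → X → A × B := fun n p x => e (Nat.find (hP' n p x))
  have hpickm : ∀ n p q, MeasurableSet {x | pick n p x = q} := by
    intro n p q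
    have : Measurable fun x => Nat.find (hP' n p x) := by
      refine measurable_find _ fun k => ?_
      have h2 : MeasurableSet {x | ∃ k', P n p x k'} := by
        rw [Set.ofPred_exists]
        exact MeasurableSet.iUnion fun k' => hPm n p k'
      exact h2.imp (hPm n p k)
    exact this (MeasurableSet.of_discrete (s := {k | e k = q}))
  let s : X → ℕ → List (A × B) := fun x n =>
    Nat.rec [] (fun n p => pick n p x :: p) n
  have hs : ∀ x n, s x (n + 1) = pick n (s x n) x :: s x n := fun x n => rfl
  have hsm : ∀ n l, MeasurableSet {x | s x n = l} := by
    intro n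
    induction n with
    | zero => exact fun l => MeasurableSet.const ([] = l)
    | succ n ih =>
      intro l
      -- There are only countably many lists, and the choice is measurable once the list is fixed.
      have : {x | s x (n + 1) = l} =
          ⋃ l', ⋃ q ∈ {q | q :: l' = l}, {x | s x n = l'} ∩ {x | pick n l' x = q} := by
        ext x
        simp [hs]
      rw [this]
      exact MeasurableSet.iUnion fun l' => MeasurableSet.biUnion (Set.to_countable _)
        fun q _ => (ih l').inter (hpickm _ _ _)
  have hmono : ∀ x m n, m ≤ n → ∀ q ∈ s x m, q ∈ s x n := by
    intro x m n hmn q hq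
    induction n, hmn using Nat.le_induction with
    | base => exact hq
    | succ n _ ih => rw [hs]; exact List.mem_cons_of_mem _ ih
  have hex : ∀ x n p, (∀ q ∈ p, ∀ q' ∈ p, C x q q') → ∃ k, P n p x k := by
    intro x n p hp
    rcases hn : t n with a | b
    · obtain ⟨b, h1, h2⟩ := forth x p hp a
      obtain ⟨k, hk⟩ := he (a, b)
      exact ⟨k, by simp [Task, hn, hk], by rwa [hk], by rwa [hk]⟩
    · obtain ⟨a, h1, h2⟩ := back x p hp b
      obtain ⟨k, hk⟩ := he (a, b)
      exact ⟨k, by simp [Task, hn, hk], by rwa [hk], by rwa [hk]⟩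
  have hpick : ∀ x n p, (∀ q ∈ p, ∀ q' ∈ p, C x q q') → Task n (pick n p x) ∧
      C x (pick n p x) (pick n p x) ∧ ∀ q ∈ p, C x (pick n p x) q := fun x n p hp =>
    Nat.find_spec (hP' n p x) (hex x n p hp)
  have hgood : ∀ x n, ∀ q ∈ s x n, ∀ q' ∈ s x n, C x q q' := by
    intro x n
    induction n with
    | zero => intro q hq; exact absurd hq List.not_mem_nil
    | succ n ih =>
      obtain ⟨-, h1, h2⟩ := hpick x n _ ih
      intro q hq q' hq'
      rw [hs, List.mem_cons] at hq hq'
      rcases hq with rfl | hq <;> rcases hq' with rfl | hq'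
      · exact h1
      · exact h2 _ hq'
      · exact hsymm _ _ _ (h2 _ hq)
      · exact ih _ hq _ hq'
  have hcompat : ∀ x m n, ∀ q ∈ s x m, ∀ q' ∈ s x n, C x q q' := fun x m n q hq q' hq' =>
    hgood x (max m n) q (hmono x _ _ (le_max_left _ _) q hq) q'
      (hmono x _ _ (le_max_right _ _) q' hq')
  have hl : ∀ x a, ∃ b n, (a, b) ∈ s x n := by
    intro x a
    obtain ⟨n, hn⟩ := ht (Sum.inl a)
    obtain ⟨h1, -⟩ := hpick x n _ (hgood x n)
    refine ⟨(pick n (s x n) x).2, n + 1, ?_⟩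
    rw [hs, List.mem_cons]
    simp only [Task, hn, Sum.elim_inl] at h1
    left
    rw [← h1]
  have hr : ∀ x b, ∃ a n, (a, b) ∈ s x n := by
    intro x b
    obtain ⟨n, hn⟩ := ht (Sum.inr b)
    obtain ⟨h1, -⟩ := hpick x n _ (hgood x n)
    refine ⟨(pick n (s x n) x).1, n + 1, ?_⟩
    rw [hs, List.mem_cons]
    simp only [Task, hn, Sum.elim_inr] at h1
    left
    rw [← h1]
  choose F nF hF using hl
  choose G nG hG using hr
  refine ⟨fun x => ⟨F x, G x, fun a => ?_, fun b => ?_⟩, fun x a a' => ?_, fun a b => ?_⟩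
  · exact (hinj x _ _ (hcompat x _ _ _ (hG x (F x a)) _ (hF x a))).2 rfl
  · exact (hinj x _ _ (hcompat x _ _ _ (hF x (G x b)) _ (hG x b))).1 rfl
  · exact hcompat x _ _ _ (hF x a) _ (hF x a')
  · have : {x | F x a = b} = ⋃ n, ⋃ l ∈ {l | (a, b) ∈ l}, {x | s x n = l} := by
      ext x
      simp only [Set.mem_ofPred_eq, Set.mem_iUnion, exists_prop, exists_eq_right']
      constructor
      · rintro rfl
        exact ⟨_, hF x a⟩
      · rintro ⟨n, hn⟩
        exact (hinj x _ _ (hcompat x _ _ _ (hF x a) _ hn)).1 rfl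
    change MeasurableSet {x | F x a = b}
    rw [this]
    exact MeasurableSet.iUnion fun n => MeasurableSet.biUnion (Set.to_countable _)
      fun l _ => hsm n l

/-- Countable tournaments with one point extensions that depend measurably on a parameter are
isomorphic, measurably in the parameter. -/
theorem exists_measurable_relIso {X A B : Type*} [MeasurableSpace X] [Countable A] [Countable B]
    [Nonempty A] (T : X → A → A → Prop) (R : B → B → Prop)
    (hTm : ∀ a a', MeasurableSet {x | T x a a'})
    (hT : ∀ x, IsTournament (T x)) (hR : IsTournament R)
    (hTe : ∀ x, HasOnePointExtensions (T x)) (hRe : HasOnePointExtensions R) :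
    ∃ h : (x : X) → T x ≃r R, ∀ a b, MeasurableSet {x | h x a = b} := by
  classical
  obtain ⟨h, hC, hm⟩ := exists_measurable_backAndForth
    (fun x (q q' : A × B) => (q.1 = q'.1 ↔ q.2 = q'.2) ∧ (T x q.1 q'.1 ↔ R q.2 q'.2))
    (fun q q' => (MeasurableSet.const _).inter ((hTm _ _).iff (MeasurableSet.const _)))
    (fun x q q' h => h.1)
    (by
      rintro x ⟨a, b⟩ ⟨a', b'⟩ ⟨h1, h2⟩
      refine ⟨by rw [eq_comm, h1, eq_comm], ?_⟩
      by_cases h : a = a'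
      · have h' := h1.1 h
        dsimp only at h h' ⊢
        subst h h'
        exact h2
      · have h' := (not_congr h1).1 h
        exact ((hT x).rel_iff_not (Ne.symm h)).trans
          ((not_congr h2).trans (hR.rel_iff_not (Ne.symm h')).symm))
    (by
      intro x p hp a
      by_cases ha : ∃ b, (a, b) ∈ p
      · obtain ⟨b, hb⟩ := ha
        exact ⟨b, hp _ hb _ hb, fun q hq => hp _ hb q hq⟩
      · obtain ⟨b, hbS, hb⟩ := hRe (p.map Prod.snd).toFinset
          (fun b => ∃ a', (a', b) ∈ p ∧ T x a a')
        refine ⟨b, ⟨by simp, iff_of_false ((hT x).irrefl _) (hR.irrefl _)⟩, ?_⟩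
        rintro ⟨a', b'⟩ hq
        have hb'S : b' ∈ (p.map Prod.snd).toFinset := by
          simpa using ⟨a', hq⟩
        refine ⟨iff_of_false ?_ ?_, ?_⟩
        · rintro rfl
          exact ha ⟨_, hq⟩
        · rintro rfl
          exact hbS hb'S
        · rw [hb b' hb'S]
          constructor
          · exact fun h => ⟨a', hq, h⟩
          · rintro ⟨a'', hq', h⟩
            obtain rfl : a'' = a' := (hp _ hq' _ hq).1.2 rfl
            exact h)
    (by
      intro x p hp b
      by_cases hb : ∃ a, (a, b) ∈ p
      · obtain ⟨a, ha⟩ := hb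
        exact ⟨a, hp _ ha _ ha, fun q hq => hp _ ha q hq⟩
      · obtain ⟨a, haS, ha⟩ := hTe x (p.map Prod.fst).toFinset
          (fun a => ∃ b', (a, b') ∈ p ∧ R b b')
        refine ⟨a, ⟨by simp, iff_of_false ((hT x).irrefl _) (hR.irrefl _)⟩, ?_⟩
        rintro ⟨a', b'⟩ hq
        have ha'S : a' ∈ (p.map Prod.fst).toFinset := by
          simpa using ⟨b', hq⟩
        refine ⟨iff_of_false ?_ ?_, ?_⟩
        · rintro rfl
          exact haS ha'S
        · rintro rfl
          exact hb ⟨_, hq⟩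
        · rw [ha a' ha'S]
          constructor
          · rintro ⟨b'', hq', h⟩
            obtain rfl : b'' = b' := (hp _ hq' _ hq).1.1 rfl
            exact h
          · exact fun h => ⟨b', hq, h⟩)
  exact ⟨fun x => ⟨h x, fun {a a'} => (hC x a a').2.symm⟩, hm⟩

/-! ### Shift-invariant tournaments from generic patterns -/

section ShiftTournament

variable {U : Type*} (E : U → U → Prop)

/-- The admissible patterns of edges between a vertex and an orbit of the shift, depending on the
labels of the two orbits: the values at `+∞` and `-∞` agree if and only if the labels are equal, and
they tell whether distinct labels are adjacent. -/
def AdmissiblePattern (u v : U) (θ : ℤ → Prop) : Prop :=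
  ∃ c d : Prop, (u = v → (c ↔ d)) ∧ (u ≠ v → (c ↔ E u v) ∧ (d ↔ ¬ E u v)) ∧
    ∃ K : ℤ, ∀ k, K < k → (θ k ↔ c) ∧ (θ (-k) ↔ d)

variable {E}

theorem AdmissiblePattern.comp_add {u v : U} {θ : ℤ → Prop} (h : AdmissiblePattern E u v θ)
    (s : ℤ) : AdmissiblePattern E u v (fun k => θ (k + s)) := by
  obtain ⟨c, d, h1, h2, K, hK⟩ := h
  refine ⟨c, d, h1, h2, K + |s|, fun k hk => ⟨?_, ?_⟩⟩
  · have := neg_abs_le s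
    exact (hK (k + s) (by linarith)).1
  · have := le_abs_self s
    have h3 := (hK (k - s) (by linarith)).2
    rwa [neg_sub', sub_neg_eq_add] at h3

/-- Seen from the other orbit, the ends are exchanged and the edges reversed, so the limits `c`, `d`
become `¬ d`, `¬ c`. For distinct labels this keeps the form `E`, `¬ E`, as `E` is symmetric. -/
theorem AdmissiblePattern.dual (hE : ∀ u v, E u v ↔ E v u) {u v : U} {θ : ℤ → Prop}
    (h : AdmissiblePattern E u v θ) : AdmissiblePattern E v u (fun k => ¬ θ (-k)) := by
  obtain ⟨c, d, h1, h2, K, hK⟩ := h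
  refine ⟨¬ d, ¬ c, fun h => ?_, fun h => ?_, K, fun k hk => ⟨?_, ?_⟩⟩
  · have := h1 h.symm
    tauto
  · have := h2 h.symm
    have := hE u v
    tauto
  · exact not_congr (hK k hk).2
  · simpa only [neg_neg] using not_congr (hK k hk).1

theorem AdmissiblePattern.map {g : Equiv.Perm U}
    (hg : ∀ u v, u ≠ v → (E u v ↔ E (g u) (g v))) {u v : U} {θ : ℤ → Prop}
    (h : AdmissiblePattern E u v θ) : AdmissiblePattern E (g u) (g v) θ := by
  obtain ⟨c, d, h1, h2, hK⟩ := h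
  refine ⟨c, d, fun h => h1 (g.injective h), fun h => ?_, hK⟩
  have h' : u ≠ v := fun h' => h (congrArg g h')
  rw [← hg u v h']
  exact h2 h'

theorem AdmissiblePattern.congr_off_finset {u v : U} {θ θ' : ℤ → Prop}
    (h : AdmissiblePattern E u v θ) (D : Finset ℤ) (hD : ∀ k, k ∉ D → (θ' k ↔ θ k)) :
    AdmissiblePattern E u v θ' := by
  obtain ⟨c, d, h1, h2, K, hK⟩ := h
  have hDK : ∀ k ∈ D, |k| ≤ ∑ k ∈ D, |k| := fun k hk =>
    Finset.single_le_sum (f := fun k => |k|) (fun k _ => abs_nonneg k) hk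
  refine ⟨c, d, h1, h2, max K (∑ k ∈ D, |k|), fun k hk => ?_⟩
  rw [max_lt_iff] at hk
  have := le_abs_self k
  rw [hD k fun h => by linarith [hDK k h], hD (-k) fun h => by linarith [hDK (-k) h, abs_neg k]]
  exact hK k hk.1

theorem admissiblePattern_step (u v : U) (c : Prop) :
    AdmissiblePattern E u v (fun k => (u = v ∧ c) ∨ (u ≠ v ∧ (0 < k ↔ E u v))) := by
  by_cases huv : u = v
  · exact ⟨c, c, fun _ => Iff.rfl, fun h => absurd huv h, 0, fun k _ => by simp [huv]⟩
  · refine ⟨E u v, ¬ E u v, fun h => absurd h huv, fun _ => ⟨Iff.rfl, Iff.rfl⟩, 0, fun k hk => ?_⟩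
    simp [huv, hk, hk.not_gt]

variable (E)

/-- A sequence of labels and patterns in which every finite family of admissible patterns occurs. -/
structure IsGenericPattern (l : ℕ → U) (pat : ℕ → ℕ → ℤ → Prop) : Prop where
  admissible : ∀ m n, AdmissiblePattern E (l n) (l m) (pat n m)
  extend : ∀ (N : ℕ) (u : U) (θ : ℕ → ℤ → Prop), (∀ m, AdmissiblePattern E u (l m) (θ m)) →
    ∃ n, N ≤ n ∧ l n = u ∧ ∀ m < N, ∀ k, (pat n m k ↔ θ m k)

/-- An admissible pattern differs on a finite set from a step function determined by the two labels
and one bit. So finite families of admissible patterns have countably many codes, which can be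
enumerated. -/
theorem exists_isGenericPattern [Countable U] [Nonempty U] :
    ∃ l pat, IsGenericPattern E l pat := by
  classical
  let base : U → U → Bool → ℤ → Prop := fun u v c k =>
    (u = v ∧ c = true) ∨ (u ≠ v ∧ (0 < k ↔ E u v))
  obtain ⟨d, hd⟩ := exists_surjective_nat (U × List (Bool × Finset ℤ))
  let l : ℕ → U := fun n => (d n.unpair.1).1
  let w : ℕ → ℕ → Bool × Finset ℤ := fun n m => (d n.unpair.1).2.getD m (true, ∅)
  -- The pattern is the symmetric difference of the step function and the coded finite set. The
  -- second component of `n.unpair` carries no data: it repeats each code at arbitrarily large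
  -- indices.
  refine ⟨l, fun n m k => ¬ (k ∈ (w n m).2 ↔ base (l n) (l m) (w n m).1 k),
    fun m n => ?_, fun N u θ hθ => ?_⟩
  · generalize w n m = p
    generalize l n = u
    generalize l m = v
    refine (admissiblePattern_step u v (p.1 = true)).congr_off_finset p.2 fun k hk => ?_
    simp only [hk, false_iff, not_not, base]
  · have hc : ∀ m, ∃ p : Bool × Finset ℤ, ∀ k, (¬ (k ∈ p.2 ↔ base u (l m) p.1 k)) ↔ θ m k := by
      intro m
      obtain ⟨c, d, h1, h2, K, hK⟩ := hθ m
      have hfin : {k | ¬ (θ m k ↔ base u (l m) (decide c) k)}.Finite := by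
        -- Beyond `K` the pattern has reached its limits; the maximum with `0` is needed because the
        -- step function may jump at `0`.
        refine (Set.finite_Icc (-(max K 0)) (max K 0)).subset fun k hk => ?_
        by_contra hk'
        rw [Set.mem_Icc, not_and_or, not_le, not_le] at hk'
        refine hk ?_
        by_cases huv : u = l m
        · have := h1 huv
          rcases hk' with hk' | hk'
          · have h3 := (hK (-k) (by linarith [le_max_left K 0])).2
            rw [neg_neg] at h3
            simp [base, ← huv, h3, this]
          · have h3 := (hK k (by linarith [le_max_left K 0])).1
            simp [base, ← huv, h3]
        · have := h2 huv
          rcases hk' with hk' | hk'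
          · have h3 := (hK (-k) (by linarith [le_max_left K 0])).2
            rw [neg_neg] at h3
            have : ¬ 0 < k := by linarith [le_max_right K 0]
            simp [base, huv, h3, h2, this]
          · have h3 := (hK k (by linarith [le_max_left K 0])).1
            have : 0 < k := by linarith [le_max_right K 0]
            simp [base, huv, h3, h2, this]
      refine ⟨(decide c, hfin.toFinset), fun k => ?_⟩
      simp only [Set.Finite.mem_toFinset, Set.mem_ofPred_eq]
      tauto
    choose p hp using hc
    obtain ⟨n, hn⟩ := hd (u, (List.range N).map p)
    refine ⟨Nat.pair n N, Nat.right_le_pair n N, by simp [l, hn], fun m hm k => ?_⟩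
    have hw : w (Nat.pair n N) m = p m := by simp [w, hn, hm]
    have hlu : l (Nat.pair n N) = u := by simp [l, hn]
    rw [hw, hlu]
    exact hp m k

variable {E} (l : ℕ → U) (pat : ℕ → ℕ → ℤ → Prop)

/-- The translation of `ℕ × ℤ` by `k` in the second coordinate. -/
def shift (k : ℤ) (a : ℕ × ℤ) : ℕ × ℤ := (a.1, a.2 + k)

/-- The shift-invariant tournament on `ℕ × ℤ` with the given patterns between distinct orbits, and
with the pattern given by the colour of the label within an orbit. -/
def shiftRel (κ : U → ℕ → Prop) (a b : ℕ × ℤ) : Prop :=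
  (a.1 = b.1 ∧ ((a.2 < b.2 ∧ κ (l a.1) (b.2 - a.2 - 1).toNat) ∨
    (b.2 < a.2 ∧ ¬ κ (l a.1) (a.2 - b.2 - 1).toNat))) ∨
  (b.1 < a.1 ∧ pat a.1 b.1 (b.2 - a.2)) ∨ (a.1 < b.1 ∧ ¬ pat b.1 a.1 (a.2 - b.2))

variable {l pat}

theorem shiftRel_of_eq {κ : U → ℕ → Prop} {a b : ℕ × ℤ} (h : a.1 = b.1) :
    shiftRel l pat κ a b ↔ (a.2 < b.2 ∧ κ (l a.1) (b.2 - a.2 - 1).toNat) ∨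
    (b.2 < a.2 ∧ ¬ κ (l a.1) (a.2 - b.2 - 1).toNat) := by
  simp [shiftRel, h]

theorem shiftRel_of_gt {κ : U → ℕ → Prop} {a b : ℕ × ℤ} (h : b.1 < a.1) :
    shiftRel l pat κ a b ↔ pat a.1 b.1 (b.2 - a.2) := by
  simp [shiftRel, h, h.ne', h.not_gt]

theorem shiftRel_of_lt {κ : U → ℕ → Prop} {a b : ℕ × ℤ} (h : a.1 < b.1) :
    shiftRel l pat κ a b ↔ ¬ pat b.1 a.1 (a.2 - b.2) := by
  simp [shiftRel, h, h.ne, h.not_gt]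

theorem shiftRel_shift (κ : U → ℕ → Prop) (k : ℤ) (a b : ℕ × ℤ) :
    shiftRel l pat κ (shift k a) (shift k b) ↔ shiftRel l pat κ a b := by
  simp [shiftRel, shift]

theorem shift_shift (j k : ℤ) (a : ℕ × ℤ) : shift j (shift k a) = shift (k + j) a := by
  simp [shift, add_assoc]

theorem shift_zero (a : ℕ × ℤ) : shift 0 a = a := by
  simp [shift]

theorem isTournament_shiftRel (κ : U → ℕ → Prop) : IsTournament (shiftRel l pat κ) := by
  refine isTournament_of_iff (fun a => by simp [shiftRel]) fun a b hab => ?_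
  rcases lt_trichotomy a.1 b.1 with h | h | h
  · rw [shiftRel_of_lt h, shiftRel_of_gt h]
  · rw [shiftRel_of_eq h, shiftRel_of_eq h.symm, ← h]
    have : a.2 ≠ b.2 := fun h' => hab (Prod.ext h h')
    rcases lt_or_gt_of_ne this with h' | h' <;> simp [h', h'.not_gt]
  · rw [shiftRel_of_lt h, shiftRel_of_gt h, not_not]

/-- The shift as an automorphism. -/
def shiftAut (κ : U → ℕ → Prop) : shiftRel l pat κ ≃r shiftRel l pat κ where
  toFun := shift 1
  invFun := shift (-1)
  left_inv a := by simp [shift_shift, shift_zero]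
  right_inv a := by simp [shift_shift, shift_zero]
  map_rel_iff' := shiftRel_shift κ 1 _ _

theorem IsGenericPattern.admissible_shiftRel (hE : ∀ u v, E u v ↔ E v u)
    (h : IsGenericPattern E l pat) (κ : U → ℕ → Prop) {a b : ℕ × ℤ} (hab : a.1 ≠ b.1) :
    AdmissiblePattern E (l a.1) (l b.1) (fun k => shiftRel l pat κ a (shift k b)) := by
  rcases lt_or_gt_of_ne hab with h' | h'
  · convert ((h.admissible a.1 b.1).dual hE).comp_add (b.2 - a.2) using 2 with k
    rw [shiftRel_of_lt (b := shift k b) h']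
    simp only [shift]
    ring_nf
  · convert (h.admissible b.1 a.1).comp_add (b.2 - a.2) using 2 with k
    rw [shiftRel_of_gt (b := shift k b) h']
    simp only [shift]
    ring_nf

/-- Finitely many values never obstruct admissibility, so a new orbit beyond those meeting `S` can
be given any prescribed edges to `S`. Its label does not matter. -/
theorem IsGenericPattern.hasOnePointExtensions [Nonempty U] (h : IsGenericPattern E l pat)
    (κ : U → ℕ → Prop) : HasOnePointExtensions (shiftRel l pat κ) := by
  classical
  intro S ε
  obtain ⟨u⟩ := ‹Nonempty U›
  obtain ⟨n, hn, -, hpat⟩ := h.extend (S.sup fun s => s.1 + 1) u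
    (fun m k => if (m, k) ∈ S then ε (m, k) else
      (u = l m ∧ True) ∨ (u ≠ l m ∧ (0 < k ↔ E u (l m))))
    (fun m => (admissiblePattern_step u (l m) True).congr_off_finset (S.image Prod.snd)
      fun k hk => by
        rw [if_neg fun h => hk (Finset.mem_image_of_mem Prod.snd h)])
  have hlt : ∀ s ∈ S, s.1 < S.sup fun s => s.1 + 1 := fun s hs =>
    Finset.le_sup (f := fun s : ℕ × ℤ => s.1 + 1) hs
  refine ⟨(n, 0), fun hmem => ?_, fun s hs => ?_⟩
  · exact absurd (hlt _ hmem) hn.not_gt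
  · rw [shiftRel_of_gt ((hlt s hs).trans_le hn), sub_zero, hpat _ (hlt s hs), if_pos hs]

end ShiftTournament

/-! ### Equivariant isomorphisms and isomorphisms of coloured graphs -/

section ShiftIso

variable {U : Type*} {E : U → U → Prop} {l : ℕ → U} {pat : ℕ → ℕ → ℤ → Prop}

theorem shiftRel_shift_self {κ : U → ℕ → Prop} (a : ℕ × ℤ) (n : ℕ) :
    shiftRel l pat κ a (shift (n + 1) a) ↔ κ (l a.1) n := by
  rw [shiftRel_of_eq (a := a) (b := shift (n + 1) a) rfl]
  have h1 : a.2 < (shift (n + 1) a).2 := by simp only [shift]; omega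
  have h2 : ((shift (n + 1) a).2 - a.2 - 1).toNat = n := by simp only [shift]; omega
  rw [h2]
  simp [h1, h1.not_gt]

/-- Compatibility of two pairs for the construction of isomorphisms that commute with the shift and
act on the labels as `g`. -/
def ShiftCompat (l : ℕ → U) (pat : ℕ → ℕ → ℤ → Prop) (κ κ' : U → ℕ → Prop) (g : U → U)
    (q q' : (ℕ × ℤ) × (ℕ × ℤ)) : Prop :=
  l q.2.1 = g (l q.1.1) ∧ l q'.2.1 = g (l q'.1.1) ∧
    (∀ k, q'.1 = shift k q.1 ↔ q'.2 = shift k q.2) ∧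
    ∀ k, shiftRel l pat κ q.1 (shift k q'.1) ↔ shiftRel l pat κ' q.2 (shift k q'.2)

theorem eq_shift_iff {a b : ℕ × ℤ} {k : ℤ} : b = shift k a ↔ a = shift (-k) b := by
  constructor
  · rintro rfl
    simp [shift_shift, shift_zero]
  · rintro rfl
    simp [shift_shift, shift_zero]

theorem exists_eq_shift_iff {a b : ℕ × ℤ} : (∃ k, b = shift k a) ↔ a.1 = b.1 := by
  constructor
  · rintro ⟨k, rfl⟩
    rfl
  · intro h
    exact ⟨b.2 - a.2, by simp [shift, h]⟩

theorem shiftRel_shift_right {κ : U → ℕ → Prop} {a b : ℕ × ℤ} {k : ℤ} (h : b ≠ shift k a) :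
    shiftRel l pat κ b (shift k a) ↔ ¬ shiftRel l pat κ a (shift (-k) b) := by
  rw [(isTournament_shiftRel κ).rel_iff_not h, ← shiftRel_shift κ (-k)]
  simp [shift_shift, shift_zero]

theorem ShiftCompat.symm {κ κ' : U → ℕ → Prop} {g : U → U} {q q' : (ℕ × ℤ) × (ℕ × ℤ)}
    (h : ShiftCompat l pat κ κ' g q q') : ShiftCompat l pat κ κ' g q' q := by
  obtain ⟨h1, h2, h3, h4⟩ := h
  have h3' : ∀ k, q.1 = shift k q'.1 ↔ q.2 = shift k q'.2 := fun k => by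
    rw [eq_shift_iff, h3, ← eq_shift_iff]
  refine ⟨h2, h1, h3', fun k => ?_⟩
  by_cases hk : q'.1 = shift k q.1
  · rw [hk, (h3 k).1 hk]
    exact iff_of_false ((isTournament_shiftRel κ).irrefl _) ((isTournament_shiftRel κ').irrefl _)
  · rw [shiftRel_shift_right hk, shiftRel_shift_right ((not_congr (h3 k)).1 hk), h4]

theorem ShiftCompat.shift_left {κ κ' : U → ℕ → Prop} {g : U → U} {a b : ℕ × ℤ}
    {q : (ℕ × ℤ) × (ℕ × ℤ)}
    (h : ShiftCompat l pat κ κ' g (a, b) q) (j : ℤ) :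
    ShiftCompat l pat κ κ' g (shift j a, shift j b) q := by
  obtain ⟨h1, h2, h3, h4⟩ := h
  refine ⟨h1, h2, fun k => ?_, fun k => ?_⟩
  · simp only [shift_shift]
    exact h3 _
  · have h5 := h4 (k - j)
    rw [← shiftRel_shift κ j, ← shiftRel_shift κ' j] at h5
    simpa only [shift_shift, sub_add_cancel] using h5

theorem shiftCompat_self {κ κ' : U → ℕ → Prop} {g : U → U} (hκ : ∀ u, κ u = κ' (g u))
    {a b : ℕ × ℤ} (h : l b.1 = g (l a.1)) : ShiftCompat l pat κ κ' g (a, b) (a, b) := by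
  refine ⟨h, h, fun k => by simp [shift, Prod.ext_iff], fun k => ?_⟩
  dsimp only
  rw [shiftRel_of_eq (a := a) (b := shift k a) rfl, shiftRel_of_eq (a := b) (b := shift k b) rfl,
    h, hκ]
  simp [shift]

/-- This makes the back step a forth step for the inverse permutation. -/
theorem shiftCompat_swap {κ κ' : U → ℕ → Prop} {g : Equiv.Perm U} {q q' : (ℕ × ℤ) × (ℕ × ℤ)} :
    ShiftCompat l pat κ κ' g q q' ↔ ShiftCompat l pat κ' κ g.symm q.swap q'.swap := by
  simp only [ShiftCompat, Prod.fst_swap, Prod.snd_swap, Equiv.eq_symm_apply]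
  refine and_congr eq_comm (and_congr eq_comm (and_congr ?_ ?_))
  · exact forall_congr' fun k => Iff.comm
  · exact forall_congr' fun k => Iff.comm

/-- If the orbit of `a` is already met, equivariance dictates the image. Otherwise the patterns from
`a` to the orbits in `p` are carried to the image orbits; they stay admissible since `g` preserves
adjacency, and genericity supplies a new orbit realising them. -/
theorem IsGenericPattern.exists_shiftCompat (hE : ∀ u v, E u v ↔ E v u)
    (h : IsGenericPattern E l pat) {κ κ' : U → ℕ → Prop} {g : Equiv.Perm U}
    (hg : ∀ u v, u ≠ v → (E u v ↔ E (g u) (g v))) (hκ : ∀ u, κ u = κ' (g u))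
    (p : List ((ℕ × ℤ) × (ℕ × ℤ))) (hp : ∀ q ∈ p, ∀ q' ∈ p, ShiftCompat l pat κ κ' g q q')
    (a : ℕ × ℤ) : ∃ b, ShiftCompat l pat κ κ' g (a, b) (a, b) ∧
      ∀ q ∈ p, ShiftCompat l pat κ κ' g (a, b) q := by
  classical
  by_cases ha : ∃ q ∈ p, ∃ k, a = shift k q.1
  · obtain ⟨⟨a', b'⟩, hq, k, rfl⟩ := ha
    exact ⟨shift k b', shiftCompat_self hκ (hp _ hq _ hq).1, fun q' hq' =>
      (hp _ hq q' hq').shift_left k⟩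
  · have hθ : ∀ m, ∃ θ, AdmissiblePattern E (g (l a.1)) (l m) θ ∧
        ∀ q ∈ p, q.2.1 = m → ∀ k, θ (q.2.2 + k) ↔ shiftRel l pat κ a (shift k q.1) := by
      intro m
      by_cases hm : ∃ q ∈ p, q.2.1 = m
      · obtain ⟨q, hq, rfl⟩ := hm
        refine ⟨fun k => shiftRel l pat κ a (shift (k - q.2.2) q.1), ?_, fun q' hq' hqq' k => ?_⟩
        · rw [(hp q hq q hq).1]
          refine AdmissiblePattern.map hg ?_
          have h1 : a.1 ≠ q.1.1 := fun h => ha ⟨q, hq, exists_eq_shift_iff.2 h.symm⟩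
          simpa only [sub_eq_add_neg] using
            (h.admissible_shiftRel hE κ h1).comp_add (-q.2.2)
        -- Pairs with images in the same orbit differ by the same shift on both sides, so the
        -- pattern does not depend on the chosen `q`.
        · have h1 : q'.2 = shift (q'.2.2 - q.2.2) q.2 := by simp [shift, ← hqq']
          have h2 := ((hp q hq q' hq').2.2.1 _).2 h1
          rw [h2, shift_shift]
          dsimp only
          rw [show q'.2.2 + k - q.2.2 = q'.2.2 - q.2.2 + k by ring]
      · exact ⟨_, admissiblePattern_step _ _ True, fun q hq hqm => absurd ⟨q, hq, hqm⟩ hm⟩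
    choose θ hθ1 hθ2 using hθ
    obtain ⟨n, hn, hln, hpat⟩ := h.extend
      (p.toFinset.sup fun q => q.2.1 + 1) (g (l a.1)) θ hθ1
    have hlt : ∀ q ∈ p, q.2.1 < n := fun q hq =>
      (Finset.le_sup (f := fun q : (ℕ × ℤ) × (ℕ × ℤ) => q.2.1 + 1)
        (List.mem_toFinset.2 hq)).trans hn
    refine ⟨(n, 0), shiftCompat_self hκ hln, fun q hq => ⟨hln, (hp q hq q hq).1,
      fun k => iff_of_false ?_ ?_, fun k => ?_⟩⟩
    · rw [eq_shift_iff]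
      exact fun h => ha ⟨q, hq, _, h⟩
    · intro h
      exact (hlt q hq).ne (congrArg Prod.fst h)
    · rw [shiftRel_of_gt (a := ((n, 0) : ℕ × ℤ)) (b := shift k q.2) (hlt q hq)]
      have hlt' : q.2.1 < p.toFinset.sup fun q => q.2.1 + 1 :=
        Finset.le_sup (f := fun q : (ℕ × ℤ) × (ℕ × ℤ) => q.2.1 + 1) (List.mem_toFinset.2 hq)
      rw [← hθ2 _ q hq rfl k, ← hpat _ hlt']
      simp [shift]

/-- An isomorphism of the coloured graphs of labels lifts to an isomorphism of the tournaments that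
commutes with the shift. -/
theorem IsGenericPattern.exists_relIso (hE : ∀ u v, E u v ↔ E v u)
    (h : IsGenericPattern E l pat) {κ κ' : U → ℕ → Prop} {g : Equiv.Perm U}
    (hg : ∀ u v, u ≠ v → (E u v ↔ E (g u) (g v))) (hκ : ∀ u, κ u = κ' (g u)) :
    ∃ ψ : shiftRel l pat κ ≃r shiftRel l pat κ', ∀ a, ψ (shift 1 a) = shift 1 (ψ a) := by
  have hg' : ∀ u v, u ≠ v → (E u v ↔ E (g.symm u) (g.symm v)) := fun u v huv => by
    rw [hg _ _ (g.symm.injective.ne huv)]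
    simp
  have hκ' : ∀ u, κ' u = κ (g.symm u) := fun u => by rw [hκ]; simp
  obtain ⟨ψ, hψ, -⟩ := exists_measurable_backAndForth (X := Unit)
    (fun _ => ShiftCompat l pat κ κ' g) (fun _ _ => MeasurableSet.const _)
    (fun _ q q' hq => by
      have := hq.2.2.1 0
      rw [shift_zero, shift_zero] at this
      rw [eq_comm, this, eq_comm])
    (fun _ q q' hq => hq.symm)
    (fun _ p hp a => h.exists_shiftCompat hE hg hκ p hp a)
    (fun _ p hp b => by
      obtain ⟨a, h1, h2⟩ := h.exists_shiftCompat hE hg' hκ' (p.map Prod.swap)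
        (by
          intro q hq q' hq'
          rw [List.mem_map] at hq hq'
          obtain ⟨q, hq, rfl⟩ := hq
          obtain ⟨q', hq', rfl⟩ := hq'
          exact shiftCompat_swap.1 (hp q hq q' hq')) b
      exact ⟨a, shiftCompat_swap.2 h1, fun q hq =>
        shiftCompat_swap.2 (h2 _ (List.mem_map_of_mem hq))⟩)
  refine ⟨⟨ψ (), fun {a a'} => ?_⟩, fun a => ?_⟩
  · have := (hψ () a a').2.2.2 0
    rw [shift_zero, shift_zero] at this
    exact this.symm
  · have h1 : ψ () (shift 1 a) = shift 1 (ψ () a) := ((hψ () a (shift 1 a)).2.2.1 1).1 rfl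
    exact h1

/-- The vertices `a` and `b` lie in distinct orbits with adjacent labels if `c` holds and with
nonadjacent labels otherwise. -/
def ShiftTail {A : Type*} (R : A → A → Prop) (s : ℤ → A → A) (c : Prop) (a b : A) : Prop :=
  ∃ K : ℤ, ∀ k, K < k → (R a (s k b) ↔ c) ∧ (R a (s (-k) b) ↔ ¬ c)

/-- For equal labels the two limits coincide, so no `c` can qualify; for distinct labels the limit
at `+∞` is adjacency. -/
theorem IsGenericPattern.shiftTail_iff (hE : ∀ u v, E u v ↔ E v u)
    (h : IsGenericPattern E l pat) {κ : U → ℕ → Prop} {a b : ℕ × ℤ} (hab : a.1 ≠ b.1) (c : Prop) :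
    ShiftTail (shiftRel l pat κ) shift c a b ↔ l a.1 ≠ l b.1 ∧ (c ↔ E (l a.1) (l b.1)) := by
  obtain ⟨c', d', h1, h2, K, hK⟩ := h.admissible_shiftRel hE κ hab
  constructor
  · rintro ⟨K', hK'⟩
    have h3 := hK (max K K' + 1) (by linarith [le_max_left K K'])
    have h4 := hK' (max K K' + 1) (by linarith [le_max_right K K'])
    have h5 := h3.1.symm.trans h4.1
    have h6 := h3.2.symm.trans h4.2
    clear h3 h4 hK hK'
    tauto
  · rintro ⟨h3, h4⟩
    have h5 := h2 h3
    exact ⟨K, fun k hk => ⟨(hK k hk).1.trans (h5.1.trans h4.symm),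
      (hK k hk).2.trans (h5.2.trans (not_congr h4.symm))⟩⟩

/-- An isomorphism of the tournaments that commutes with the shift induces an isomorphism of the
coloured graphs of labels. -/
theorem IsGenericPattern.exists_perm (hE : ∀ u v, E u v ↔ E v u)
    (h : IsGenericPattern E l pat) {κ κ' : U → ℕ → Prop}
    (ψ : shiftRel l pat κ ≃r shiftRel l pat κ') (hψ : ∀ a, ψ (shift 1 a) = shift 1 (ψ a)) :
    ∃ g : Equiv.Perm U, (∀ u v, u ≠ v → (E u v ↔ E (g u) (g v))) ∧ ∀ u, κ u = κ' (g u) := by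
  have hψn : ∀ (n : ℕ) a, ψ (shift n a) = shift n (ψ a) := by
    intro n
    induction n with
    | zero => simp [shift_zero]
    | succ n ih =>
      intro a
      have := hψ (shift n a)
      rw [ih, shift_shift, shift_shift] at this
      exact_mod_cast this
  have hψk : ∀ (k : ℤ) a, ψ (shift k a) = shift k (ψ a) := by
    intro k a
    obtain ⟨n, rfl | rfl⟩ := k.eq_nat_or_neg
    · exact hψn n a
    · rw [← neg_neg (n : ℤ), neg_neg, eq_shift_iff, neg_neg, ← hψn, shift_shift]
      simp [shift_zero]
  have horb : ∀ a b, a.1 = b.1 ↔ (ψ a).1 = (ψ b).1 := fun a b => by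
    rw [← exists_eq_shift_iff, ← exists_eq_shift_iff]
    refine exists_congr fun k => ?_
    rw [← hψk, ψ.injective.eq_iff]
  have htail : ∀ c a b, ShiftTail (shiftRel l pat κ) shift c a b ↔
      ShiftTail (shiftRel l pat κ') shift c (ψ a) (ψ b) := fun c a b => by
    simp only [ShiftTail, ← hψk, ψ.map_rel_iff]
  have hlab : ∀ a b, l a.1 = l b.1 ↔ l (ψ a).1 = l (ψ b).1 := fun a b => by
    by_cases hab : a.1 = b.1
    · rw [hab, (horb a b).1 hab]
      simp
    · have h1 := h.shiftTail_iff hE (κ := κ) hab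
      have h2 := h.shiftTail_iff hE (κ := κ') ((not_congr (horb a b)).1 hab)
      -- With `c` the adjacency of the labels on one side, the tail condition on that side says just
      -- that the labels differ; the two choices of `c` give the two implications.
      have h3 := htail (E (l a.1) (l b.1)) a b
      have h4 := htail (E (l (ψ a).1) (l (ψ b).1)) a b
      rw [h1, h2] at h3 h4
      tauto
  have hadj : ∀ a b, l a.1 ≠ l b.1 → (E (l a.1) (l b.1) ↔ E (l (ψ a).1) (l (ψ b).1)) := by
    intro a b hab
    have hab' : a.1 ≠ b.1 := fun h => hab (congrArg l h)
    have h3 := htail (E (l a.1) (l b.1)) a b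
    rw [h.shiftTail_iff hE hab', h.shiftTail_iff hE ((not_congr (horb a b)).1 hab')] at h3
    tauto
  have hl : ∀ u, ∃ a : ℕ × ℤ, l a.1 = u := fun u => by
    obtain ⟨n, -, hn, -⟩ := h.extend 0 u
      (fun m k => (u = l m ∧ True) ∨ (u ≠ l m ∧ (0 < k ↔ E u (l m))))
      (fun m => admissiblePattern_step _ _ _)
    exact ⟨(n, 0), hn⟩
  choose r hr using hl
  refine ⟨Equiv.ofBijective (fun u => l (ψ (r u)).1) ⟨fun u v huv => ?_, fun u => ?_⟩,
    fun u v huv => ?_, fun u => ?_⟩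
  · rw [← hlab, hr, hr] at huv
    exact huv
  · refine ⟨l (ψ.symm (r u)).1, ?_⟩
    have := (hlab (r (l (ψ.symm (r u)).1)) (ψ.symm (r u))).1 (hr _)
    dsimp only
    rw [this, ψ.apply_symm_apply, hr]
  · have := hadj (r u) (r v)
    rw [hr, hr] at this
    exact this huv
  · ext n
    have h1 := shiftRel_shift_self (l := l) (pat := pat) (κ := κ) (r u) n
    have h2 := shiftRel_shift_self (l := l) (pat := pat) (κ := κ') (ψ (r u)) n
    rw [← hψk, ψ.map_rel_iff, h1, hr] at h2
    exact h2

end ShiftIso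

/-! ### Coding structures by coloured graphs -/

/-- The incidence graph whose vertices are the natural numbers and the positions in finite
sequences of natural numbers: positions of the same sequence are adjacent, and each position is
adjacent to the number that the sequence has there. -/
def positionAdj : ℕ ⊕ (List ℕ × ℕ) → ℕ ⊕ (List ℕ × ℕ) → Prop
  | Sum.inl _, Sum.inl _ => False
  | Sum.inl x, Sum.inr q => q.1[q.2]? = some x
  | Sum.inr q, Sum.inl x => q.1[q.2]? = some x
  | Sum.inr q, Sum.inr q' => q.1 = q'.1

theorem positionAdj_comm (u v : ℕ ⊕ (List ℕ × ℕ)) : positionAdj u v ↔ positionAdj v u := by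
  rcases u with x | q <;> rcases v with y | q' <;> simp [positionAdj, eq_comm]

/-- The colours of the vertices of the incidence graph that encode a structure. The colour of a
position in a sequence records the position and the relations that hold of the sequence. -/
def positionColor {I : Type} [Countable I] {arity : I → ℕ} (M : ModSpace arity) :
    ℕ ⊕ (List ℕ × ℕ) → ℕ → Prop
  | Sum.inl _, n => n = 0
  | Sum.inr q, n => n = 2 * q.2 + 1 ∨
      ∃ i : I, n = 2 * (exists_injective_nat I).choose i + 2 ∧ ∃ x ∈ M i, List.ofFn x = q.1

theorem exists_mem_ofFn_eq_iff {I : Type} {arity : I → ℕ} (M N : ModSpace arity) (g : Equiv.Perm ℕ) (i : I) :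
    (∀ x, x ∈ M i ↔ g ∘ x ∈ N i) ↔ ∀ s : List ℕ,
      (∃ x ∈ M i, List.ofFn x = s) ↔ ∃ x ∈ N i, List.ofFn x = s.map g := by
  constructor
  · intro h s
    constructor
    · rintro ⟨x, hx, rfl⟩
      exact ⟨g ∘ x, (h x).1 hx, by rw [List.map_ofFn]⟩
    · rintro ⟨x, hx, hs⟩
      refine ⟨g.symm ∘ x, (h _).2 ?_, ?_⟩
      · rwa [← Function.comp_assoc, Equiv.self_comp_symm, Function.id_comp]
      · rw [← List.map_ofFn, hs, List.map_map, Equiv.symm_comp_self, List.map_id]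
  · intro h x
    have h1 := h (List.ofFn x)
    simp only [List.map_ofFn, List.ofFn_inj, exists_eq_right] at h1
    exact h1

section Coding

variable {I : Type} [Countable I] {arity : I → ℕ}

theorem positionColor_inr_odd (M : ModSpace arity) (q : List ℕ × ℕ) (j : ℕ) :
    positionColor M (Sum.inr q) (2 * j + 1) ↔ j = q.2 := by
  simp only [positionColor]
  constructor
  · rintro (h | ⟨i, h, -⟩) <;> omega
  · rintro rfl
    exact Or.inl rfl

theorem positionColor_inr_even (M : ModSpace arity) (q : List ℕ × ℕ) (i : I) :
    positionColor M (Sum.inr q) (2 * (exists_injective_nat I).choose i + 2) ↔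
      ∃ x ∈ M i, List.ofFn x = q.1 := by
  simp only [positionColor]
  constructor
  · rintro (h | ⟨i', h, h'⟩)
    · omega
    · obtain rfl : i = i' := (exists_injective_nat I).choose_spec (by omega)
      exact h'
  · exact fun h => Or.inr ⟨i, rfl, h⟩

theorem positionColor_zero (M : ModSpace arity) (u : ℕ ⊕ (List ℕ × ℕ)) :
    positionColor M u 0 ↔ ∃ x, u = Sum.inl x := by
  rcases u with x | q
  · simp [positionColor]
  · simp [positionColor]

theorem measurableSet_positionColor (u : ℕ ⊕ (List ℕ × ℕ)) (n : ℕ) :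
    MeasurableSet {M : ModSpace arity | positionColor M u n} := by
  rcases u with x | q
  · exact MeasurableSet.const _
  · have : {M : ModSpace arity | positionColor M (Sum.inr q) n} = {_M | n = 2 * q.2 + 1} ∪
        ⋃ i : I, ⋃ x : Fin (arity i) → ℕ, {_M | n = 2 * (exists_injective_nat I).choose i + 2} ∩
          ({M | x ∈ M i} ∩ {_M | List.ofFn x = q.1}) := by
      ext M
      simp [positionColor]
    rw [this]
    refine (MeasurableSet.const _).union (MeasurableSet.iUnion fun i => MeasurableSet.iUnion
      fun x => (MeasurableSet.const _).inter (MeasurableSet.inter ?_ (MeasurableSet.const _)))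
    exact ((measurable_set_mem x).comp (measurable_pi_apply i)).setOf

/-- Two structures are isomorphic if and only if their coloured incidence graphs are. -/
theorem isoSetoid_iff_exists_perm (M N : ModSpace arity) :
    isoSetoid arity M N ↔ ∃ G : Equiv.Perm (ℕ ⊕ (List ℕ × ℕ)),
      (∀ u v, u ≠ v → (positionAdj u v ↔ positionAdj (G u) (G v))) ∧
      ∀ u, positionColor M u = positionColor N (G u) := by
  constructor
  · rintro ⟨g, hg⟩
    refine ⟨Equiv.sumCongr g (Equiv.prodCongr (Equiv.listEquivOfEquiv g) (Equiv.refl ℕ)), ?_, ?_⟩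
    · have hmap : ∀ (s : List ℕ) (i x : ℕ), s[i]? = some x ↔ (s.map g)[i]? = some (g x) := by
        intro s i x
        simp
      rintro (x | ⟨s, i⟩) (y | ⟨s', i'⟩) -
      · rfl
      · exact hmap _ _ _
      · exact hmap _ _ _
      · exact (List.map_injective_iff.2 g.injective).eq_iff.symm
    · rintro (x | ⟨s, j⟩)
      · rfl
      · ext n
        refine or_congr Iff.rfl (exists_congr fun i => and_congr Iff.rfl ?_)
        exact (exists_mem_ofFn_eq_iff M N g i).1 (hg i) s
  · rintro ⟨G, hadj, hcol⟩
    have hinl : ∀ u, (∃ x, u = Sum.inl x) ↔ ∃ y, G u = Sum.inl y := fun u => by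
      rw [← positionColor_zero M, ← positionColor_zero N, hcol]
    have hx : ∀ x, ∃ y, G (Sum.inl x) = Sum.inl y := fun x => (hinl _).1 ⟨x, rfl⟩
    choose g₀ hg₀ using hx
    have hbij : Function.Bijective g₀ := by
      refine ⟨fun x y hxy => ?_, fun y => ?_⟩
      · have : G (Sum.inl x) = G (Sum.inl y) := by rw [hg₀, hg₀, hxy]
        exact Sum.inl_injective (G.injective this)
      · obtain ⟨x, hx⟩ := (hinl (G.symm (Sum.inl y))).2 ⟨y, by simp⟩
        refine ⟨x, Sum.inl_injective (β := List ℕ × ℕ) ?_⟩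
        rw [← hg₀, ← hx, G.apply_symm_apply]
    let g : Equiv.Perm ℕ := Equiv.ofBijective g₀ hbij
    -- Colours fix the position, the edges between positions keep each sequence together, and the
    -- edges to numbers determine its entries.
    have hpos : ∀ q, ∃ s, G (Sum.inr q) = Sum.inr (s, q.2) := by
      intro q
      rcases hq : G (Sum.inr q) with y | ⟨s, j⟩
      · obtain ⟨x, hx⟩ := (hinl _).2 ⟨y, hq⟩
        exact absurd hx Sum.inr_ne_inl
      · have h1 := (positionColor_inr_odd M q q.2).2 rfl
        rw [hcol, hq, positionColor_inr_odd] at h1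
        exact ⟨s, by rw [h1]⟩
    have hseq : ∀ s : List ℕ, ∃ s', ∀ j, G (Sum.inr (s, j)) = Sum.inr (s', j) := by
      intro s
      obtain ⟨s', hs'⟩ := hpos (s, 0)
      refine ⟨s', fun j => ?_⟩
      by_cases hj : j = 0
      · rw [hj, hs']
      · obtain ⟨s'', hs''⟩ := hpos (s, j)
        have h1 := (hadj (Sum.inr (s, 0)) (Sum.inr (s, j)) (by simpa using Ne.symm hj)).1 rfl
        rw [hs', hs''] at h1
        obtain rfl : s' = s'' := h1
        exact hs''
    have hmap : ∀ (s : List ℕ) (j : ℕ), G (Sum.inr (s, j)) = Sum.inr (s.map g, j) := by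
      intro s j
      obtain ⟨s', hs'⟩ := hseq s
      suffices s' = s.map g by rw [hs', this]
      refine List.ext_getElem? fun i => Option.ext fun y => ?_
      obtain ⟨x, rfl⟩ := g.surjective y
      have h1 := hadj (Sum.inl x) (Sum.inr (s, i)) Sum.inl_ne_inr
      rw [hs', hg₀] at h1
      have h2 : s[i]? = some x ↔ s'[i]? = some (g x) := h1
      rw [← h2]
      simp
    refine ⟨g, fun i => (exists_mem_ofFn_eq_iff M N g i).2 fun s => ?_⟩
    -- Position `0` exists as a vertex even for the empty sequence, so nullary relations are coded
    -- too.
    rw [← positionColor_inr_even M (s, 0), hcol, hmap, positionColor_inr_even]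

end Coding

/-! ### The Borel reduction to conjugacy -/

/-- Conjugacy of automorphisms transported along isomorphisms to a fixed structure. -/
theorem isConj_transport_iff {A V : Type*} {S T : A → A → Prop} {R : V → V → Prop}
    (h : S ≃r R) (k : T ≃r R) (φ : S ≃r S) (χ : T ≃r T) :
    IsConj (α := R ≃r R) ((h.symm.trans φ).trans h) ((k.symm.trans χ).trans k) ↔
      ∃ ψ : S ≃r T, ∀ a, ψ (φ a) = χ (ψ a) := by
  rw [isConj_iff]
  constructor
  · rintro ⟨c, hc⟩
    rw [mul_inv_eq_iff_eq_mul] at hc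
    refine ⟨(h.trans c).trans k.symm, fun a => ?_⟩
    have h1 := DFunLike.congr_fun hc (h a)
    simp only [RelIso.mul_apply, RelIso.trans_apply, RelIso.symm_apply_apply] at h1
    simp [h1]
  · rintro ⟨ψ, hψ⟩
    refine ⟨(h.symm.trans ψ).trans k, ?_⟩
    rw [mul_inv_eq_iff_eq_mul]
    ext v
    simp [RelIso.mul_apply, hψ]

/-- The conjugacy relation of the automorphism group of the random tournament is Borel complete. -/
theorem IsRandomTournament.borelComplete_conjugacy {V : Type*} [Countable V] {R : V → V → Prop}
    (hR : IsRandomTournament R) : BorelComplete (conjugacy (R ≃r R)) := by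
  intro I _ arity C _
  obtain ⟨l, pat, hgen⟩ := exists_isGenericPattern positionAdj
  let T : C → ℕ × ℤ → ℕ × ℤ → Prop := fun M => shiftRel l pat (positionColor M.1)
  have hTm : ∀ a b, MeasurableSet {M | T M a b} := by
    intro a b
    have hcol : ∀ u n, MeasurableSet {M : C | positionColor M.1 u n} := fun u n =>
      measurable_subtype_coe (measurableSet_positionColor u n)
    -- Only the edges inside an orbit depend on the structure.
    exact ((MeasurableSet.const _).inter (((MeasurableSet.const _).inter (hcol _ _)).union
      ((MeasurableSet.const _).inter (hcol _ _).compl))).union (MeasurableSet.const _)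
  obtain ⟨h, hm⟩ := exists_measurable_relIso T R hTm (fun M => isTournament_shiftRel _)
    hR.isTournament (fun M => hgen.hasOnePointExtensions _) hR.hasOnePointExtensions
  refine ⟨fun M => ((h M).symm.trans (shiftAut _)).trans (h M), ?_, fun M N => ?_⟩
  · refine Measurable.of_le_map (iSup_le fun v => ?_)
    rw [← measurable_iff_le_map, measurable_comap_iff]
    let _ : MeasurableSpace V := ⊤
    refine measurable_to_countable' fun w => ?_
    -- Ranging over the countably many possible preimages `a` of `v` avoids the inverse of `h M`.
    have : (fun M => (((h M).symm.trans (shiftAut _)).trans (h M)) v) ⁻¹' {w} =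
        ⋃ a, {M | h M a = v} ∩ {M | h M (shift 1 a) = w} := by
      ext M
      simp only [Set.mem_preimage, Set.mem_singleton_iff, Set.mem_iUnion, Set.mem_inter_iff,
        Set.mem_ofPred_eq]
      constructor
      · intro hw
        exact ⟨(h M).symm v, (h M).apply_symm_apply v, hw⟩
      · rintro ⟨a, rfl, rfl⟩
        simp [shiftAut]
    exact this ▸ MeasurableSet.iUnion fun a => (hm _ _).inter (hm _ _)
  · refine (isoSetoid_iff_exists_perm M.1 N.1).trans (Iff.trans ?_
      (isConj_transport_iff (h M) (h N) (shiftAut _) (shiftAut _)).symm)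
    constructor
    · rintro ⟨g, hg, hκ⟩
      exact hgen.exists_relIso positionAdj_comm hg hκ
    · rintro ⟨ψ, hψ⟩
      exact hgen.exists_perm positionAdj_comm ψ hψ

theorem mainTheorem2 {V : Type*} [Countable V] (R : V → V → Prop) (hR : IsRandomTournament R) :
    BorelReducible (isoOn tournaments) (conjugacy (R ≃r R)) ∧
      BorelComplete (conjugacy (R ≃r R)) :=
  ⟨hR.borelComplete_conjugacy Unit (fun _ => 2) tournaments measurableSet_tournaments,
    hR.borelComplete_conjugacy⟩
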